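/- For integers $q\ge 1$, $a$, $d\ge 1$, $n\ge 0$ let $$S(q,a)=\sum_{t=1}^{q}e^{2\pi i a t^2/q},\qquad A_d(q,n)=\sum_{\substack{1\le a\le q\\ (a,q)=1}}\bigl(q^{-1}S(q,a)\bigr)^d e^{-2\pi i n a/q},$$ and let the singular series be $$\mathfrak S_d(n)=\sum_{q=1}^{\infty}A_d(q,n).$$ Let $d\ge 5$ be an integer. There exists a constant $C>0$ (depending only on $d$) such that for every integer $n\ge 0$ the series defining $\mathfrak S_d(n)$ converges absolutely, its sum is a real number, and $$\mathfrak S_d(n)\ge C .$$ -/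

import Mathlib

/-- The quadratic Gauss sum `S(q, a) = ∑_{t=1}^q e^{2πi a t² / q}`. -/
noncomputable def quadGaussSum (q a : ℕ) : ℂ :=
  ∑ t ∈ Finset.Icc 1 q,
    Complex.exp (2 * (Real.pi : ℂ) * Complex.I * (((a : ℂ) * (t : ℂ) ^ 2) / (q : ℂ)))

/-- The term `A_d(q, n) = ∑_{1 ≤ a ≤ q, (a, q) = 1} (q⁻¹ S(q, a))^d e^{2πi (-n a / q)}`. -/
noncomputable def singularTerm (d q n : ℕ) : ℂ :=
  ∑ a ∈ (Finset.Icc 1 q).filter (fun a => Nat.Coprime a q),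
    ((q : ℂ)⁻¹ * quadGaussSum q a) ^ d *
      Complex.exp (2 * (Real.pi : ℂ) * Complex.I * (-((n : ℂ) * (a : ℂ)) / (q : ℂ)))

/-- The singular series `𝔖_d(n) = ∑_{q=1}^∞ A_d(q, n)`. -/
noncomputable def singularSeries (d n : ℕ) : ℂ :=
  ∑' q : ℕ+, singularTerm d (q : ℕ) n

open Finset

/-! The sum of `A_d(q, n)` over `q ∣ M` is `N(M) / M ^ (d - 1)`, with `N(M)` the number of solutions
of `∑ xᵢ² = n` modulo `M` (`sum_divisors_singularTerm_eq`). It is therefore real, and it suffices to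
bound it below along multiples of every modulus, avoiding an Euler product.

Absolute convergence, uniform in `n`, yields a fixed `l` such that for `M` coprime to `l` the terms
with `q ≠ 1` total at most `1/2` against `A_d(1, n) = 1`. For moduli `4 * l * l ^ K`, four squares
and a Hensel-type argument give a density bound independent of `K` and `n` (`pow_le_sumSqCount`).
The Chinese remainder theorem multiplies the two bounds. -/

theorem sum_Icc_one_eq_sum_range {R : Type*} [AddCommMonoid R] (h : ℕ → R) (m : ℕ)
    (hm : h m = h 0) : ∑ t ∈ Icc 1 m, h t = ∑ t ∈ range m, h t := by
  rcases Nat.eq_zero_or_pos m with rfl | hpos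
  · simp
  · rw [Finset.sum_range_eq_add_Ico h hpos, ← hm, add_comm, ← Finset.sum_Ico_succ_top hpos]
    rfl

theorem sum_range_natCast_zmod {R : Type*} [AddCommMonoid R] (q : ℕ) [NeZero q] (F : ZMod q → R) :
    ∑ t ∈ range q, F t = ∑ x, F x := by
  refine Finset.sum_nbij' (fun t => (t : ZMod q)) ZMod.val ?_ ?_ ?_ ?_ ?_
  · simp
  · intro x _; simpa using ZMod.val_lt x
  · intro t ht; exact ZMod.val_cast_of_lt (by simpa using ht)
  · intro x _; simp
  · simp

theorem sum_range_mul_natCast_zmod {R : Type*} [AddCommMonoid R] (q : ℕ) [NeZero q]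
    (F : ZMod q → R) (g : ℕ) :
    ∑ t ∈ range (g * q), F t = g • ∑ x, F x := by
  induction g with
  | zero => simp
  | succ g ih =>
    rw [add_mul, one_mul, Finset.sum_range_add, ih, add_smul, one_smul]
    simp [sum_range_natCast_zmod]

theorem sum_Icc_mul_natCast_zmod {R : Type*} [AddCommMonoid R] (q : ℕ) [NeZero q]
    (F : ZMod q → R) (g : ℕ) :
    ∑ t ∈ Icc 1 (g * q), F t = g • ∑ x, F x := by
  rw [sum_Icc_one_eq_sum_range (fun t : ℕ => F t) _ (by simp), sum_range_mul_natCast_zmod]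

theorem sum_Icc_natCast_zmod {R : Type*} [AddCommMonoid R] (q : ℕ) [NeZero q] (F : ZMod q → R) :
    ∑ t ∈ Icc 1 q, F t = ∑ x, F x := by
  simpa using sum_Icc_mul_natCast_zmod q F 1

/-! ### Divisor sums of the series as solution counts -/

theorem stdAddChar_natCast_eq_exp (q : ℕ) [NeZero q] (a : ℕ) :
    ZMod.stdAddChar (a : ZMod q) = Complex.exp (2 * (Real.pi : ℂ) * Complex.I * ((a : ℂ) / q)) := by
  have := ZMod.stdAddChar_coe (N := q) (a : ℤ)
  push_cast at this
  rw [this]; congr 1; ring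

theorem stdAddChar_neg_natCast_eq_exp (q : ℕ) [NeZero q] (a : ℕ) :
    ZMod.stdAddChar (-(a : ZMod q)) =
      Complex.exp (2 * (Real.pi : ℂ) * Complex.I * (-(a : ℂ) / q)) := by
  have := ZMod.stdAddChar_coe (N := q) (-(a : ℤ))
  push_cast at this
  rw [this]; congr 1; ring

theorem quadGaussSum_eq_sum_stdAddChar (q : ℕ) [NeZero q] (a : ℕ) :
    quadGaussSum q a = ∑ t : ZMod q, ZMod.stdAddChar ((a : ZMod q) * t ^ 2) := by
  rw [← sum_Icc_natCast_zmod, quadGaussSum]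
  refine Finset.sum_congr rfl fun t _ => ?_
  have := stdAddChar_natCast_eq_exp q (a * t ^ 2)
  push_cast at this
  exact this.symm

theorem quadGaussSum_mul_mul (g q a : ℕ) [NeZero q] (hg : g ≠ 0) :
    quadGaussSum (g * q) (g * a) = g * quadGaussSum q a := by
  rw [quadGaussSum_eq_sum_stdAddChar q a, ← nsmul_eq_mul, ← sum_Icc_mul_natCast_zmod, quadGaussSum]
  refine Finset.sum_congr rfl fun t _ => ?_
  have := stdAddChar_natCast_eq_exp q (a * t ^ 2)
  push_cast at this
  rw [this]
  congr 2
  have hg' : (g : ℂ) ≠ 0 := by exact_mod_cast hg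
  push_cast
  rw [mul_assoc, mul_div_mul_left _ _ hg']

/-- The summand of the singular series attached to the fraction `a / q`. -/
noncomputable def singularSummand (d n q a : ℕ) : ℂ :=
  ((q : ℂ)⁻¹ * quadGaussSum q a) ^ d *
    Complex.exp (2 * (Real.pi : ℂ) * Complex.I * (-((n : ℂ) * (a : ℂ)) / (q : ℂ)))

theorem singularSummand_mul_mul (d n g q a : ℕ) [NeZero q] (hg : g ≠ 0) :
    singularSummand d n (g * q) (g * a) = singularSummand d n q a := by
  have hg' : (g : ℂ) ≠ 0 := by exact_mod_cast hg
  have hq : (q : ℂ) ≠ 0 := by exact_mod_cast NeZero.ne q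
  rw [singularSummand, singularSummand, quadGaussSum_mul_mul g q a hg]
  congr 2
  · push_cast; field_simp
  · push_cast; field_simp

/-- Each `b / M` reduces to a unique `a / q` in lowest terms with `q ∣ M`, and the summand depends
only on the fraction. -/
theorem sum_divisors_singularTerm (d n M : ℕ) (hM : M ≠ 0) :
    ∑ q ∈ M.divisors, singularTerm d q n = ∑ b ∈ Icc 1 M, singularSummand d n M b := by
  have h1 : ∑ b ∈ Icc 1 M, singularSummand d n M b =
      ∑ q ∈ M.divisors, ∑ b ∈ (Icc 1 M).filter (fun b => M / Nat.gcd b M = q),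
        singularSummand d n M b := by
    refine (Finset.sum_fiberwise_of_maps_to (fun b _ => ?_) _).symm
    exact Nat.mem_divisors.2 ⟨Nat.div_dvd_of_dvd (Nat.gcd_dvd_right b M), hM⟩
  rw [h1]
  refine Finset.sum_congr rfl fun q hq => ?_
  obtain ⟨⟨g, rfl⟩, -⟩ := Nat.mem_divisors.1 hq
  have hq0 : q ≠ 0 := left_ne_zero_of_mul hM
  have hg0 : g ≠ 0 := right_ne_zero_of_mul hM
  have : NeZero q := ⟨hq0⟩
  rw [singularTerm]
  refine Finset.sum_nbij (fun a => g * a) ?_ ?_ ?_ ?_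
  · intro a ha
    simp only [mem_filter, mem_Icc] at ha ⊢
    refine ⟨⟨Nat.mul_pos (Nat.pos_of_ne_zero hg0) ha.1.1, ?_⟩, ?_⟩
    · rw [mul_comm q]; exact Nat.mul_le_mul_left g ha.1.2
    · rw [mul_comm q, Nat.gcd_mul_left, ha.2.gcd_eq_one, mul_one,
        Nat.mul_div_cancel_left _ (Nat.pos_of_ne_zero hg0)]
  · intro a _ b _ hab
    exact Nat.eq_of_mul_eq_mul_left (Nat.pos_of_ne_zero hg0) hab
  · intro b hb
    simp only [coe_filter, mem_Icc, Set.mem_ofPred_eq] at hb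
    obtain ⟨⟨hb1, hb2⟩, hb3⟩ := hb
    have hgcd : Nat.gcd b (q * g) = g := by
      have := Nat.div_mul_cancel (Nat.gcd_dvd_right b (q * g))
      rw [hb3] at this
      exact Nat.eq_of_mul_eq_mul_left (Nat.pos_of_ne_zero hq0) this
    have hgb : g ∣ b := by rw [← hgcd]; exact Nat.gcd_dvd_left _ _
    obtain ⟨a, rfl⟩ := hgb
    refine ⟨a, ?_, rfl⟩
    simp only [coe_filter, mem_Icc, Set.mem_ofPred_eq]
    refine ⟨⟨Nat.pos_of_ne_zero ?_, ?_⟩, ?_⟩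
    · rintro rfl; simp at hb1
    · rw [mul_comm q] at hb2
      exact Nat.le_of_mul_le_mul_left hb2 (Nat.pos_of_ne_zero hg0)
    · rw [mul_comm q, Nat.gcd_mul_left] at hgcd
      exact Nat.eq_of_mul_eq_mul_left (Nat.pos_of_ne_zero hg0) (by simpa using hgcd)
  · intro a _
    rw [mul_comm q, singularSummand_mul_mul d n g q a hg0]
    rfl

/-- The number of solutions of `∑ xᵢ² = n` in `(ℤ/M)^d`. -/
noncomputable def sumSqCount (d M n : ℕ) : ℕ :=
  Nat.card {x : Fin d → ZMod M // ∑ i, x i ^ 2 = n}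

theorem AddChar.map_sum_eq_prod {ι A R : Type*} [AddCommMonoid A] [CommMonoid R] (ψ : AddChar A R)
    (s : Finset ι) (f : ι → A) : ψ (∑ i ∈ s, f i) = ∏ i ∈ s, ψ (f i) :=
  map_prod ψ.toMonoidHom (fun i => Multiplicative.ofAdd (f i)) s

/-- Orthogonality of additive characters, after expanding the `d`-th power of the Gauss sum. -/
theorem sum_singularSummand (d n M : ℕ) [NeZero M] :
    (M : ℂ) ^ d * ∑ b ∈ Icc 1 M, singularSummand d n M b = M * sumSqCount d M n := by
  classical
  have hM : (M : ℂ) ≠ 0 := by exact_mod_cast NeZero.ne M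
  have key : ∀ b : ℕ, (M : ℂ) ^ d * singularSummand d n M b =
      ∑ x : Fin d → ZMod M, ZMod.stdAddChar ((b : ZMod M) * (∑ i, x i ^ 2 - (n : ZMod M))) := by
    intro b
    rw [singularSummand, mul_pow, inv_pow, ← mul_assoc, ← mul_assoc,
      mul_inv_cancel₀ (pow_ne_zero _ hM), one_mul, quadGaussSum_eq_sum_stdAddChar]
    have h2 := stdAddChar_neg_natCast_eq_exp M (n * b)
    push_cast at h2
    rw [← h2, Fintype.sum_pow, Finset.sum_mul]
    refine Finset.sum_congr rfl fun x _ => ?_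
    rw [mul_sub, sub_eq_add_neg, AddChar.map_add_eq_mul, Finset.mul_sum, AddChar.map_sum_eq_prod,
      mul_comm (b : ZMod M) n]
  rw [Finset.mul_sum, Finset.sum_congr rfl fun b _ => key b,
    sum_Icc_natCast_zmod M (fun b => ∑ x : Fin d → ZMod M,
      ZMod.stdAddChar (b * (∑ i, x i ^ 2 - (n : ZMod M)))), Finset.sum_comm]
  simp_rw [AddChar.sum_mulShift _ (ZMod.isPrimitive_stdAddChar M), ZMod.card]
  rw [sumSqCount, Nat.card_eq_fintype_card, Fintype.card_subtype]
  simp [sub_eq_zero, Finset.sum_ite, mul_comm]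

theorem sumSqCount_mul_le (d n M₁ M₂ : ℕ) [NeZero M₁] [NeZero M₂] (h : M₁.Coprime M₂) :
    sumSqCount d M₁ n * sumSqCount d M₂ n ≤ sumSqCount d (M₁ * M₂) n := by
  have : NeZero (M₁ * M₂) := ⟨mul_ne_zero (NeZero.ne _) (NeZero.ne _)⟩
  rw [sumSqCount, sumSqCount, sumSqCount, ← Nat.card_prod]
  let e := ZMod.chineseRemainder h
  refine Nat.card_le_card_of_injective
    (fun p => ⟨fun i => e.symm (p.1.1 i, p.2.1 i), ?_⟩) ?_
  · apply e.injective
    simp only [map_sum, map_pow, RingEquiv.apply_symm_apply, map_natCast]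
    ext
    · simp [Prod.fst_sum, p.1.2]
    · simp [Prod.snd_sum, p.2.2]
  · rintro ⟨⟨x, hx⟩, ⟨y, hy⟩⟩ ⟨⟨x', hx'⟩, ⟨y', hy'⟩⟩ hxy
    have hxy' : ∀ i, (x i, y i) = (x' i, y' i) := fun i =>
      e.symm.injective (congrFun (congrArg Subtype.val hxy) i)
    simp only [Prod.mk.injEq] at hxy' ⊢
    exact ⟨Subtype.ext (funext fun i => (hxy' i).1), Subtype.ext (funext fun i => (hxy' i).2)⟩

/-! ### Local densities at the bad modulus -/

/-- Values at `z` and `w` differ by `(z - w)(1 + l(z + w))`, whose second factor is a unit because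
`l` is nilpotent. The map is thus injective on a finite ring, hence surjective. -/
theorem exists_add_mul_sq_modEq (l K : ℕ) (hl : l ≠ 0) (v : ℤ) :
    ∃ z : ℤ, (l : ℤ) ^ K ∣ z + l * z ^ 2 - v := by
  have : NeZero (l ^ K) := ⟨pow_ne_zero _ hl⟩
  have hnil : IsNilpotent (l : ZMod (l ^ K)) :=
    ⟨K, by rw [← Nat.cast_pow, ZMod.natCast_self]⟩
  have hinj : Function.Injective (fun z : ZMod (l ^ K) => z + l * z ^ 2) := by
    intro z w hzw
    have hu : IsUnit (1 + (l : ZMod (l ^ K)) * (z + w)) :=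
      IsNilpotent.isUnit_one_add (Commute.isNilpotent_mul_right (Commute.all _ _) hnil)
    have h0 : (1 + (l : ZMod (l ^ K)) * (z + w)) * (z - w) = 0 := by
      have : z + l * z ^ 2 = w + l * w ^ 2 := hzw
      linear_combination this
    exact sub_eq_zero.1 (hu.mul_right_eq_zero.1 h0)
  obtain ⟨z, hz⟩ := Finite.surjective_of_injective hinj (v : ZMod (l ^ K))
  obtain ⟨z, rfl⟩ := ZMod.intCast_surjective z
  refine ⟨z, ?_⟩
  have := (ZMod.intCast_zmod_eq_zero_iff_dvd (z + l * z ^ 2 - v) (l ^ K)).1 (by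
    push_cast; exact sub_eq_zero.2 hz)
  exact_mod_cast this

theorem exists_sq_modEq (l K : ℕ) (hl : l ≠ 0) (u : ℤ) (hu : (4 * l : ℤ) ∣ u - 1) :
    ∃ y : ℤ, ((4 * l * l ^ K : ℕ) : ℤ) ∣ y ^ 2 - u := by
  obtain ⟨v, hv⟩ := hu
  obtain ⟨z, hz⟩ := exists_add_mul_sq_modEq l K hl v
  -- `(1 + 2lz)² = 1 + 4l(z + lz²)`.
  refine ⟨1 + 2 * l * z, ?_⟩
  have : (1 + 2 * l * z) ^ 2 - u = 4 * l * (z + l * z ^ 2 - v) := by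
    linear_combination -hv
  rw [this]
  push_cast
  exact mul_dvd_mul_left _ hz

theorem exists_sum_sq_add_one (k m n : ℕ) (hm : m ≠ 0) :
    ∃ c : Fin (k + 4) → ℤ, (m : ℤ) ∣ (n - ∑ i, c i ^ 2) - 1 := by
  -- Adding `m` keeps the natural subtraction exact when `n = 0`.
  obtain ⟨a, b, c, e, h⟩ := Nat.sum_four_squares (n + m - 1)
  refine ⟨Fin.cons a (Fin.cons b (Fin.cons c (Fin.cons e 0))), -1, ?_⟩
  have h' : ((a ^ 2 + b ^ 2 + c ^ 2 + e ^ 2 : ℕ) : ℤ) = n + m - 1 := by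
    rw [h]; omega
  push_cast at h'
  simp [Fin.sum_univ_succ]
  linarith

/-- All coordinates but the first range freely over fixed classes modulo `4l`, chosen so that the
remainder is `1` modulo `4l` and hence a square. -/
theorem pow_le_sumSqCount (k l K n : ℕ) (hl : l ≠ 0) :
    (l ^ K) ^ (k + 4) ≤ sumSqCount (k + 5) (4 * l * l ^ K) n := by
  set M := 4 * l * l ^ K with hM
  have : NeZero M := ⟨by positivity⟩
  obtain ⟨c, hc⟩ := exists_sum_sq_add_one k (4 * l) n (by positivity)
  let x : (Fin (k + 4) → Fin (l ^ K)) → Fin (k + 4) → ℤ := fun w i => c i + 4 * l * (w i : ℕ)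
  have hx : ∀ w, ∃ y : ℤ, (M : ℤ) ∣ y ^ 2 - (n - ∑ i, x w i ^ 2) := by
    intro w
    refine exists_sq_modEq l K hl _ ?_
    have h1 : (4 * l : ℤ) ∣ ∑ i, (x w i ^ 2 - c i ^ 2) := by
      refine Finset.dvd_sum fun i _ => ⟨(w i : ℕ) * (2 * c i + 4 * l * (w i : ℕ)), ?_⟩
      simp only [x]; ring
    have h2 := dvd_sub hc (by exact_mod_cast h1)
    rw [Finset.sum_sub_distrib] at h2
    push_cast at h2
    obtain ⟨t, ht⟩ := h2
    exact ⟨t, by linarith⟩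
  choose y hy using hx
  have hcard : (l ^ K) ^ (k + 4) = Nat.card (Fin (k + 4) → Fin (l ^ K)) := by simp
  rw [hcard, sumSqCount]
  refine Nat.card_le_card_of_injective
    (fun w => ⟨Fin.cons (y w : ZMod M) (fun i => (x w i : ZMod M)), ?_⟩) ?_
  · have h0 := (ZMod.intCast_zmod_eq_zero_iff_dvd _ M).2 (hy w)
    push_cast at h0
    rw [Fin.sum_univ_succ]
    simp only [Fin.cons_zero, Fin.cons_succ]
    linear_combination h0
  · intro w w' h
    have h' := congrArg Subtype.val h
    funext i
    have hi : ((x w i : ℤ) : ZMod M) = (x w' i : ℤ) := by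
      simpa using congrFun h' i.succ
    rw [ZMod.intCast_eq_intCast_iff_dvd_sub] at hi
    have hd : x w' i - x w i = (4 * l) * ((w' i : ℕ) - (w i : ℕ) : ℤ) := by simp only [x]; ring
    have hM' : (M : ℤ) = (4 * l) * (l ^ K : ℕ) := by rw [hM]; push_cast; ring
    rw [hd, hM'] at hi
    have hi' := Int.dvd_of_mul_dvd_mul_left (by positivity) hi
    have h1 := (w i).2
    have h2 := (w' i).2
    have := Int.eq_zero_of_abs_lt_dvd hi' (by rw [abs_lt]; constructor <;> omega)
    ext; omega

theorem exists_dvd_pow_mul_coprime (l : ℕ) (hl : l ≠ 0) (Q : ℕ) (hQ : Q ≠ 0) :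
    ∃ K M, M ≠ 0 ∧ l.Coprime M ∧ Q ∣ l ^ K * M := by
  induction Q using Nat.strong_induction_on with
  | _ Q ih =>
    by_cases hg : l.gcd Q = 1
    · exact ⟨0, Q, hQ, hg, by simp⟩
    · obtain ⟨Q', hQ'⟩ := Nat.gcd_dvd_right l Q
      have hg0 : l.gcd Q ≠ 0 := by simp [hl]
      have hQ'0 : Q' ≠ 0 := by rintro rfl; simp at hQ'; exact hQ hQ'
      have hlt : Q' < Q := by
        have : 2 ≤ l.gcd Q := by omega
        nlinarith [Nat.pos_of_ne_zero hQ'0]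
      obtain ⟨K, M, hM, hc, hd⟩ := ih Q' hlt hQ'0
      refine ⟨K + 1, M, hM, hc, ?_⟩
      rw [hQ', pow_succ', mul_assoc]
      exact mul_dvd_mul (Nat.gcd_dvd_left _ _) hd

/-! ### Absolute convergence, uniform in `n` -/

/-- Weyl differencing: summing over the base point leaves only the shifts `h` with `2ah = 0`, of
which there are at most two. -/
theorem norm_quadGaussSum_sq_le (q a : ℕ) [NeZero q] (ha : a.Coprime q) :
    ‖quadGaussSum q a‖ ^ 2 ≤ 2 * q := by
  classical
  set ψ : AddChar (ZMod q) ℂ := ZMod.stdAddChar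
  have hexp : quadGaussSum q a * (starRingEnd ℂ) (quadGaussSum q a) =
      ∑ h : ZMod q, ψ (a * h ^ 2) * if 2 * a * h = 0 then (q : ℂ) else 0 := by
    have hsum : ∀ b : ZMod q, ∑ s, ψ (s * b) = if b = 0 then (q : ℂ) else 0 := fun b => by
      have := AddChar.sum_mulShift b (ZMod.isPrimitive_stdAddChar q)
      rw [ZMod.card] at this
      rw [this]; split_ifs <;> simp
    simp_rw [← hsum, Finset.mul_sum]
    rw [quadGaussSum_eq_sum_stdAddChar, map_sum, Finset.sum_mul_sum, Finset.sum_comm,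
      Finset.sum_comm (γ := ZMod q)]
    rw [Finset.sum_comm]
    conv_rhs => rw [Finset.sum_comm]
    refine Finset.sum_congr rfl fun s _ => ?_
    rw [← Equiv.sum_comp (Equiv.addRight s)]
    refine Finset.sum_congr rfl fun h _ => ?_
    rw [← AddChar.map_neg_eq_conj, ← AddChar.map_add_eq_mul, ← AddChar.map_add_eq_mul]
    congr 1
    simp only [Equiv.coe_addRight]
    ring
  have hu : IsUnit (a : ZMod q) := (ZMod.isUnit_iff_coprime a q).2 ha
  have hcard : #{h : ZMod q | 2 * a * h = 0} ≤ 2 := by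
    have h2 := IsAddCyclic.card_nsmul_eq_zero_le (α := ZMod q) (n := 2) (by norm_num)
    refine le_trans (Finset.card_le_card fun h hh => ?_) h2
    simp only [mem_filter, mem_univ, true_and, nsmul_eq_mul, Nat.cast_ofNat] at hh ⊢
    exact hu.mul_right_eq_zero.1 (by rw [← hh]; ring)
  have hnorm : ‖quadGaussSum q a‖ ^ 2 = ‖quadGaussSum q a * (starRingEnd ℂ) (quadGaussSum q a)‖ := by
    rw [norm_mul, RCLike.norm_conj, sq]
  rw [hnorm, hexp]
  calc _ ≤ ∑ h : ZMod q, if 2 * a * h = 0 then (q : ℝ) else 0 := by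
        refine norm_sum_le_of_le _ fun h _ => ?_
        rw [norm_mul, AddChar.norm_apply, one_mul]
        split_ifs <;> simp
    _ = #{h : ZMod q | 2 * a * h = 0} * q := by
        rw [← Finset.sum_filter, Finset.sum_const, nsmul_eq_mul]
    _ ≤ 2 * q := by
        gcongr
        exact_mod_cast hcard

theorem norm_quadGaussSum_le (q a : ℕ) [NeZero q] : ‖quadGaussSum q a‖ ≤ q := by
  rw [quadGaussSum_eq_sum_stdAddChar]
  refine (norm_sum_le_of_le _ (fun t _ => (AddChar.norm_apply _ _).le)).trans ?_
  simp [ZMod.card]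

theorem norm_singularTerm_le (d q n : ℕ) (hd : 5 ≤ d) :
    ‖singularTerm d q n‖ ≤ 8 / (q : ℝ) ^ (3 / 2 : ℝ) := by
  rcases Nat.eq_zero_or_pos q with rfl | hq
  · simp [singularTerm]
  have : NeZero q := ⟨hq.ne'⟩
  have hq' : (0 : ℝ) < q := by exact_mod_cast hq
  set s := √(q : ℝ)
  have hs : 0 < s := Real.sqrt_pos.2 hq'
  have hs2 : s ^ 2 = q := Real.sq_sqrt hq'.le
  have hpow : (q : ℝ) ^ (3 / 2 : ℝ) = s ^ 3 := by
    simp only [s]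
    rw [Real.sqrt_eq_rpow, ← Real.rpow_natCast, ← Real.rpow_mul hq'.le]; norm_num
  have hterm : ∀ a ∈ (Icc 1 q).filter (fun a => Nat.Coprime a q),
      ‖((q : ℂ)⁻¹ * quadGaussSum q a) ^ d *
        Complex.exp (2 * (Real.pi : ℂ) * Complex.I * (-((n : ℂ) * (a : ℂ)) / (q : ℂ)))‖
      ≤ 8 / s ^ 5 := by
    intro a ha
    have hexp : ‖Complex.exp (2 * (Real.pi : ℂ) * Complex.I *
        (-((n : ℂ) * (a : ℂ)) / (q : ℂ)))‖ = 1 := by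
      have : 2 * (Real.pi : ℂ) * Complex.I * (-((n : ℂ) * (a : ℂ)) / (q : ℂ)) =
          ((2 * Real.pi * (-((n : ℝ) * a) / q) : ℝ) : ℂ) * Complex.I := by push_cast; ring
      rw [this, Complex.norm_exp_ofReal_mul_I]
    rw [norm_mul, hexp, mul_one, norm_pow]
    set r := ‖(q : ℂ)⁻¹ * quadGaussSum q a‖ with hr
    have hr0 : 0 ≤ r := norm_nonneg _
    have hrq : r * q = ‖quadGaussSum q a‖ := by
      rw [hr, norm_mul, norm_inv, Complex.norm_natCast]; field_simp
    have hr1 : r ≤ 1 := by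
      have := norm_quadGaussSum_le q a
      rw [← hrq] at this
      exact le_of_mul_le_mul_right (by linarith) hq'
    have hr2 : (r * s) ^ 2 ≤ 2 := by
      have := norm_quadGaussSum_sq_le q a (mem_filter.1 ha).2
      rw [← hrq] at this
      refine le_of_mul_le_mul_right ?_ hq'
      calc (r * s) ^ 2 * q = (r * q) ^ 2 := by rw [mul_pow, hs2]; ring
        _ ≤ _ := this
    -- A rational bound for `√2`; then `(3/2)^5 < 8`.
    have hrs : r * s ≤ 3 / 2 := by nlinarith [mul_nonneg hr0 hs.le]
    have h5 : (r * s) ^ 5 ≤ (3 / 2) ^ 5 := pow_le_pow_left₀ (mul_nonneg hr0 hs.le) hrs 5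
    calc r ^ d ≤ r ^ 5 := pow_le_pow_of_le_one hr0 hr1 hd
      _ ≤ 8 / s ^ 5 := by
        rw [le_div_iff₀ (by positivity), ← mul_pow]
        exact h5.trans (by norm_num)
  rw [hpow, singularTerm]
  refine (norm_sum_le_of_le _ hterm).trans ?_
  rw [Finset.sum_const, nsmul_eq_mul]
  have hc : (#((Icc 1 q).filter (fun a => Nat.Coprime a q)) : ℝ) ≤ s ^ 2 := by
    rw [hs2]
    have := Finset.card_filter_le (Icc 1 q) (fun a => Nat.Coprime a q)
    simp only [Nat.card_Icc, add_tsub_cancel_right] at this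
    exact_mod_cast this
  calc _ ≤ s ^ 2 * (8 / s ^ 5) := by gcongr
    _ = 8 / s ^ 3 := by field_simp

theorem summable_eight_div_rpow : Summable (fun q : ℕ => 8 / (q : ℝ) ^ (3 / 2 : ℝ)) := by
  have := (Real.summable_one_div_nat_rpow.2 (by norm_num : (1 : ℝ) < 3 / 2)).mul_left 8
  simpa [div_eq_mul_inv] using this

theorem summable_singularTerm (d n : ℕ) (hd : 5 ≤ d) : Summable (fun q => singularTerm d q n) :=
  Summable.of_norm_bounded summable_eight_div_rpow fun q => norm_singularTerm_le d q n hd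

theorem sum_divisors_singularTerm_eq (k n M : ℕ) (hM : M ≠ 0) :
    ∑ q ∈ M.divisors, singularTerm (k + 1) q n =
      ((sumSqCount (k + 1) M n / (M : ℝ) ^ k : ℝ) : ℂ) := by
  have : NeZero M := ⟨hM⟩
  have hM' : (M : ℂ) ≠ 0 := by exact_mod_cast hM
  have h := sum_singularSummand (k + 1) n M
  rw [sum_divisors_singularTerm _ _ _ hM]
  push_cast
  rw [eq_div_iff (pow_ne_zero _ hM')]
  apply mul_left_cancel₀ hM'
  rw [← h]; ring

theorem singularTerm_one (d n : ℕ) : singularTerm d 1 n = 1 := by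
  have h : Complex.exp (2 * (Real.pi : ℂ) * Complex.I * -(n : ℂ)) = 1 := by
    have := Complex.exp_int_mul_two_pi_mul_I (-(n : ℤ))
    push_cast at this
    rw [← this]; ring_nf
  rw [mul_neg] at h
  have h' := Complex.exp_two_pi_mul_I
  simp [singularTerm, quadGaussSum, h, h']

/-- There is a modulus `l`, independent of `n`, such that the local densities away from `l` are at
least `1/2`. -/
theorem exists_modulus_half_le_sumSqCount :
    ∃ l : ℕ, l ≠ 0 ∧ 2 ∣ l ∧ ∀ k n M : ℕ, M ≠ 0 → l.Coprime M →
      (1 / 2 : ℝ) ≤ sumSqCount (k + 5) M n / (M : ℝ) ^ (k + 4) := by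
  obtain ⟨s, hs⟩ := summable_iff_vanishing_norm.1 summable_eight_div_rpow (1 / 2) (by norm_num)
  -- Every positive `q ∈ s` divides this factorial, so divisors `q ≠ 1` of `M` avoid `s`. The `+ 2`
  -- makes it even.
  refine ⟨(s.sup id + 2).factorial, Nat.factorial_ne_zero _,
    Nat.dvd_factorial two_pos (by omega), fun k n M hM hcop => ?_⟩
  have hsum := sum_divisors_singularTerm_eq (k + 4) n M hM
  have hone : 1 ∈ M.divisors := by simp [hM]
  rw [← Finset.add_sum_erase _ _ hone, singularTerm_one] at hsum
  have hdisj : Disjoint (M.divisors.erase 1) s := by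
    rw [Finset.disjoint_left]
    intro q hq hqs
    rw [Finset.mem_erase, Nat.mem_divisors] at hq
    have hle : q ≤ s.sup id + 2 := (Finset.le_sup (f := id) hqs).trans (by omega)
    have hq0 : 0 < q := Nat.pos_of_ne_zero fun h => hM (by simpa [h] using hq.2.1)
    have h1 := Nat.dvd_gcd (Nat.dvd_factorial hq0 hle) hq.2.1
    rw [hcop.gcd_eq_one] at h1
    exact hq.1 (Nat.dvd_one.1 h1)
  have htail : ‖∑ q ∈ M.divisors.erase 1, singularTerm (k + 4 + 1) q n‖ ≤ 1 / 2 := by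
    refine (norm_sum_le_of_le _ fun q _ => norm_singularTerm_le _ q n (by omega)).trans ?_
    exact (le_abs_self _).trans (hs _ hdisj).le
  have hre := congrArg Complex.re hsum
  rw [Complex.add_re, Complex.one_re, Complex.ofReal_re] at hre
  have := (abs_le.1 ((Complex.abs_re_le_norm _).trans htail)).1
  linarith

theorem corollary3p7 (d : ℕ) (hd : 5 ≤ d) :
    ∃ C : ℝ, 0 < C ∧ ∀ n : ℕ,
      Summable (fun q : ℕ+ => singularTerm d (q : ℕ) n) ∧
      (singularSeries d n).im = 0 ∧
      C ≤ (singularSeries d n).re := by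
  obtain ⟨l, hl, h2l, hhalf⟩ := exists_modulus_half_le_sumSqCount
  obtain ⟨k, rfl⟩ : ∃ k, d = k + 5 := ⟨d - 5, by omega⟩
  have hl' : (0 : ℝ) < l := by exact_mod_cast Nat.pos_of_ne_zero hl
  refine ⟨1 / (4 * l : ℝ) ^ (k + 4) * (1 / 2), by positivity, fun n => ?_⟩
  have hsummable := summable_singularTerm (k + 5) n hd
  refine ⟨hsummable.comp_injective PNat.coe_injective, ?_⟩
  have hseries : singularSeries (k + 5) n = ∑' q : ℕ, singularTerm (k + 5) q n := by
    refine PNat.coe_injective.tsum_eq (f := fun q => singularTerm (k + 5) q n) fun q hq => ?_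
    rcases Nat.eq_zero_or_pos q with rfl | hpos
    · simp [singularTerm] at hq
    · exact ⟨⟨q, hpos⟩, rfl⟩
  have hlim : Filter.Tendsto (fun s : Finset ℕ => ∑ q ∈ s, singularTerm (k + 5) q n)
      Filter.atTop (nhds (singularSeries (k + 5) n)) := hseries ▸ hsummable.hasSum
  have hclosed : IsClosed {z : ℂ | z.im = 0 ∧ 1 / (4 * l : ℝ) ^ (k + 4) * (1 / 2) ≤ z.re} :=
    (isClosed_eq Complex.continuous_im continuous_const).inter
      (isClosed_le continuous_const Complex.continuous_re)
  -- Only a cofinal family of partial sums needs the bound; sets of divisors supply it.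
  refine hclosed.mem_of_frequently_of_tendsto ?_ hlim
  rw [Filter.frequently_atTop]
  intro s
  obtain ⟨K, M, hM, hcop, hdvd⟩ := exists_dvd_pow_mul_coprime l hl (∏ q ∈ s.erase 0, q)
    (Finset.prod_ne_zero_iff.2 fun q hq => (Finset.mem_erase.1 hq).1)
  set L := 4 * l * l ^ K with hL
  have hL0 : L ≠ 0 := by positivity
  have hcop' : L.Coprime M := by
    -- Evenness of `l` handles the factor `4` in `L`.
    have h2 : Nat.Coprime 2 M := hcop.coprime_dvd_left h2l
    exact ((h2.mul_left h2).mul_left hcop).mul_left (hcop.pow_left K)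
  have : NeZero L := ⟨hL0⟩
  have : NeZero M := ⟨hM⟩
  -- The given finite set may contain `0`, whose term vanishes.
  refine ⟨insert 0 (L * M).divisors, fun q hq => ?_, ?_⟩
  · rw [Finset.mem_insert, Nat.mem_divisors]
    refine or_iff_not_imp_left.2 fun hq0 => ⟨?_, mul_ne_zero hL0 hM⟩
    refine ((Finset.dvd_prod_of_mem _ (Finset.mem_erase.2 ⟨hq0, hq⟩)).trans hdvd).trans ?_
    exact mul_dvd_mul_right (Dvd.intro_left _ rfl) M
  · have h0 : singularTerm (k + 5) 0 n = 0 := by simp [singularTerm]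
    rw [Finset.sum_insert_zero (f := fun q => singularTerm (k + 5) q n) h0, sum_divisors_singularTerm_eq (k + 4) n _ (mul_ne_zero hL0 hM)]
    refine ⟨Complex.ofReal_im _, ?_⟩
    rw [Complex.ofReal_re]
    have hcast : ((l ^ K : ℕ) : ℝ) ^ (k + 4) ≤ sumSqCount (k + 5) L n := by
      exact_mod_cast pow_le_sumSqCount k l K n hl
    have hmul : (sumSqCount (k + 5) L n : ℝ) * sumSqCount (k + 5) M n ≤
        sumSqCount (k + 5) (L * M) n := by
      exact_mod_cast sumSqCount_mul_le (k + 5) n L M hcop'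
    calc 1 / (4 * l : ℝ) ^ (k + 4) * (1 / 2)
        ≤ sumSqCount (k + 5) L n / (L : ℝ) ^ (k + 4) *
          (sumSqCount (k + 5) M n / (M : ℝ) ^ (k + 4)) := by
          refine mul_le_mul ?_ (hhalf k n M hM hcop) (by norm_num) (by positivity)
          rw [le_div_iff₀ (by positivity)]
          refine le_trans (le_of_eq ?_) hcast
          have h4 : (4 * l : ℝ) ≠ 0 := by positivity
          rw [hL]
          push_cast
          rw [mul_pow (4 * l : ℝ), one_div, inv_mul_cancel_left₀ (pow_ne_zero _ h4)]
      _ = sumSqCount (k + 5) L n * sumSqCount (k + 5) M n / ((L * M : ℕ) : ℝ) ^ (k + 4) := by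
          rw [div_mul_div_comm, Nat.cast_mul L M, mul_pow (L : ℝ)]
      _ ≤ _ := by gcongr
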